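/- Let $m\ge 2$ be an integer and let $A$ be a set containing $0$. An $m$-automaton $D=(V,E)$ with output in $A$ is a finite digraph (multiple edges and loops allowed) in which every vertex is labelled by an element of $A$, one vertex is additionally labelled "Start", every vertex has exactly $m$ outgoing edges, labelled by $0,1,\dots,m-1$ in some order, every edge labelled $0$ connects two vertices with the same label in $A$, and every vertex can be reached from Start by a walk. Its automatic sequence $(a_k)$ is defined as follows: if $k=\sum_{i=0}^{n} b_i m^i$ with $0\le b_i<m$, then $a_k\in A$ is the label of the vertex reached from Start by consecutively following the edges labelled $b_0,b_1,\dots,b_n$. For $N\ge 1$ put $E_N=\{k : 1\le k\le N,\ a_k\ne 0\}$. A vertex $v$ is called tied if (i) there is a (possibly empty) walk from $v$ to a vertex whose label is not $0$, and (ii) there are two different walks (sequences of edges) of the same length from $v$ to $v$. Let $V'\subseteq V$ be the set of tied vertices. For $v\in V$ let $D_v$ be the subdigraph of $D$ consisting of all vertices $u$ such that there are (possibly empty) walks from $u$ to $v$ and from $v$ to $u$, together with all edges between such vertices, and let $\rho_v$ be the spectral radius of $D_v$, i.e. the maximum of $|\lambda|$ over the complex eigenvalues $\lambda$ of its adjacency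 matrix, whose $(u,w)$ entry is the number of edges from $u$ to $w$. **Theorem.** Let $$S=\{\alpha>0 : \#E_N\ge N^{\alpha}\text{ for all sufficiently large } N\}.$$ If $V'\neq\emptyset$, then $S$ is non-empty and bounded above, and $$\sup S = B,\qquad\text{where } B:=\max_{v\in V'}\log_m(\rho_v).$$ If $V'=\emptyset$, then $S=\emptyset$ (so both the supremum and the maximum are taken over the empty set). -/

import Mathlib

/-- An `m`-automaton with vertex set `V` and output in `A`. The edges are the pairs
`(v, d) : V × Fin m`; the edge `(v, d)` leaves `v`, is labelled `d` and ends in `next v d`. So every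
vertex has exactly `m` outgoing edges, with distinct labels in `{0, …, m - 1}`. -/
structure MAutomaton (m : ℕ) (A : Type*) [Zero A] (V : Type*) where
  /-- the vertex labelled `Start` -/
  start : V
  /-- the end vertex of the edge with label `d` leaving `v` -/
  next : V → Fin m → V
  /-- the output label of a vertex -/
  label : V → A
  /-- leading zero invariance: an edge labelled `0` connects vertices with the same label -/
  leadingZero : ∀ (v : V) (d : Fin m), (d : ℕ) = 0 → label (next v d) = label v
  /-- accessibility: every vertex is the end of a walk from `Start` -/
  accessible : ∀ v : V, ∃ w : List (Fin m), w.foldl next start = v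

namespace MAutomaton

variable {m : ℕ} {A : Type*} [Zero A] {V : Type*}

/-- The end vertex of the walk that starts in `v` and whose consecutive edges are labelled by the
entries of `w`. As every vertex has exactly one outgoing edge with a given label, the walks starting
in `v` correspond bijectively to the words `w`; the length of the walk is the length of the word. -/
def walkEnd (D : MAutomaton m A V) (v : V) (w : List (Fin m)) : V :=
  w.foldl D.next v

/-- There is a (possibly empty) walk from `u` to `v`. -/
def Reaches (D : MAutomaton m A V) (u v : V) : Prop :=
  ∃ w : List (Fin m), D.walkEnd u w = v

/-- The sequence generated by the automaton: `a_k` is the label of the vertex reached from `Start`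
by following the base-`m` digits of `k`, least significant digit first. -/
def sequence (D : MAutomaton m A V) (hm : 2 ≤ m) (k : ℕ) : A :=
  D.label (D.walkEnd D.start
    ((Nat.digits m k).pmap (fun d hd => (⟨d, hd⟩ : Fin m))
      (fun _ hd => Nat.digits_lt_base hm hd)))

/-- The set of tied vertices: those from which a vertex with non-zero label can be reached and from
which there are two different closed walks of the same length. -/
def tied (D : MAutomaton m A V) : Set V :=
  {v | (∃ u : V, D.Reaches v u ∧ D.label u ≠ 0) ∧
    ∃ w₁ w₂ : List (Fin m), w₁ ≠ w₂ ∧ w₁.length = w₂.length ∧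
      D.walkEnd v w₁ = v ∧ D.walkEnd v w₂ = v}

/-- The vertex set of the strongly connected subdigraph at `v`. -/
def component (D : MAutomaton m A V) (v : V) : Set V :=
  {u | D.Reaches u v ∧ D.Reaches v u}

/-- The adjacency matrix of the strongly connected subdigraph at `v`, that is of the subdigraph
induced on `component v`: its entry at `(u, w)` is the number of edges from `u` to `w`. -/
noncomputable def adjMatrix (D : MAutomaton m A V) (v : V) :
    Matrix (D.component v) (D.component v) ℂ :=
  Matrix.of fun u w => (Nat.card {d : Fin m // D.next u d = w} : ℂ)

open Classical in
/-- The spectral radius of the vertex `v`: the largest absolute value of a complex eigenvalue of the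
adjacency matrix of the strongly connected subdigraph at `v`. -/
noncomputable def rho [Fintype V] (D : MAutomaton m A V) (v : V) : ℝ :=
  (spectralRadius ℂ (D.adjMatrix v)).toReal

end MAutomaton

/-- The support of the sequence `a` up to `N`: the integers `1 ≤ k ≤ N` with `a k ≠ 0`. -/
def supportUpTo {A : Type*} [Zero A] (a : ℕ → A) (N : ℕ) : Set ℕ :=
  {k | 1 ≤ k ∧ k ≤ N ∧ a k ≠ 0}

/-- The exponents `α > 0` such that the support of `a` up to `N` has at least `N ^ α` elements for
all sufficiently large `N`. -/
def growthExponents {A : Type*} [Zero A] (a : ℕ → A) : Set ℝ :=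
  {α | 0 < α ∧ ∃ N₀ : ℕ, ∀ N : ℕ, N₀ ≤ N → (N : ℝ) ^ α ≤ ((supportUpTo a N).ncard : ℝ)}

/-! ### Spectral radius and growth of the entries of matrix powers. -/

namespace Matrix

variable {ι : Type*} [Fintype ι] [DecidableEq ι]

/-! For `N` near `m ^ n`, the support up to `N` is controlled by the words of length about `n`
leading from Start to a non-zero label, that is, by a sum of entries of the `n`-th power of the edge
matrix. Upper bound: only live vertices contribute. The edge matrix cut down to them is block
triangular along strongly connected components, so its spectral radius is at most the largest `rho`
of a live vertex (`spectralRadius_liveMatrix_le`), and Gelfand's formula bounds its powers. Lower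
bound: some entry of the `n`-th power inside the component of a live `v` is at least `rho v ^ n /
card V`, and connecting walks of bounded length extend these walks to start in Start and end at a
non-zero label. Among live vertices, the tied ones are exactly those with `rho > 1`, so only they
yield positive exponents. -/

theorem mem_spectrum_iff_exists_mulVec_eq_smul {K : Type*} [Field K] (A : Matrix ι ι K) (z : K) :
    z ∈ spectrum K A ↔ ∃ x : ι → K, x ≠ 0 ∧ A *ᵥ x = z • x := by
  rw [spectrum.mem_iff, Matrix.isUnit_iff_isUnit_det, isUnit_iff_ne_zero, not_not,
    ← Matrix.exists_mulVec_eq_zero_iff]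
  refine exists_congr fun x => and_congr_right fun _ => ?_
  rw [Matrix.sub_mulVec, sub_eq_zero, Matrix.algebraMap_eq_diagonal]
  have : Matrix.diagonal (algebraMap K (ι → K) z) *ᵥ x = z • x := by
    ext i
    simp [Matrix.mulVec_diagonal]
  rw [this, eq_comm]

section

attribute [local instance] Matrix.linftyOpNormedRing Matrix.linftyOpNormedAlgebra

theorem spectralRadius_ne_top [Nonempty ι] (A : Matrix ι ι ℂ) : spectralRadius ℂ A ≠ ⊤ := by
  have : CompleteSpace (Matrix ι ι ℂ) := FiniteDimensional.complete ℂ _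
  obtain ⟨z, -, hz⟩ := spectrum.exists_nnnorm_eq_spectralRadius A
  exact hz ▸ ENNReal.coe_ne_top

theorem exists_mulVec_eq_smul_norm_eq_spectralRadius [Nonempty ι] (A : Matrix ι ι ℂ) :
    ∃ (z : ℂ) (x : ι → ℂ), x ≠ 0 ∧ A *ᵥ x = z • x ∧ ‖z‖ = (spectralRadius ℂ A).toReal := by
  have : CompleteSpace (Matrix ι ι ℂ) := FiniteDimensional.complete ℂ _
  obtain ⟨z, hz, h⟩ := spectrum.exists_nnnorm_eq_spectralRadius A
  obtain ⟨x, hx, hAx⟩ := (mem_spectrum_iff_exists_mulVec_eq_smul A z).1 hz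
  exact ⟨z, x, hx, hAx, by rw [← h]; simp⟩

theorem norm_le_spectralRadius_of_mulVec_eq_smul [Nonempty ι] (A : Matrix ι ι ℂ) {z : ℂ}
    {x : ι → ℂ} (hx : x ≠ 0) (h : A *ᵥ x = z • x) : ‖z‖ ≤ (spectralRadius ℂ A).toReal := by
  have hz := (mem_spectrum_iff_exists_mulVec_eq_smul A z).2 ⟨x, hx, h⟩
  have : (‖z‖₊ : ENNReal) ≤ spectralRadius ℂ A := le_iSup₂ (f := fun k _ => (‖k‖₊ : ENNReal)) z hz
  simpa using ENNReal.toReal_mono (spectralRadius_ne_top A) this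

/-- Gelfand's formula gives `‖A ^ n‖ ≤ r ^ n` from some point on; `C` absorbs the finitely many
earlier powers. -/
theorem exists_norm_pow_apply_le [Nonempty ι] (A : Matrix ι ι ℂ) {r : ℝ}
    (hr : (spectralRadius ℂ A).toReal < r) :
    ∃ C : ℝ, 0 ≤ C ∧ ∀ (n : ℕ) (i j : ι), ‖(A ^ n) i j‖ ≤ C * r ^ n := by
  have : CompleteSpace (Matrix ι ι ℂ) := FiniteDimensional.complete ℂ _
  have hr0 : 0 < r := ENNReal.toReal_nonneg.trans_lt hr
  have hr' : spectralRadius ℂ A < ENNReal.ofReal r :=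
    (ENNReal.lt_ofReal_iff_toReal_lt (spectralRadius_ne_top A)).2 hr
  have hev := (spectrum.pow_norm_pow_one_div_tendsto_nhds_spectralRadius A).eventually_lt_const hr'
  obtain ⟨n₀, hn₀⟩ := Filter.eventually_atTop.1 hev
  have hbig : ∀ n, n₀ + 1 ≤ n → ‖A ^ n‖ ≤ r ^ n := by
    intro n hn
    have h1 := ((ENNReal.ofReal_lt_ofReal_iff hr0).1 (hn₀ n (by omega))).le
    have h2 := pow_le_pow_left₀ (by positivity) h1 n
    rwa [one_div, Real.rpow_inv_natCast_pow (norm_nonneg _) (by omega)] at h2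
  have hentry : ∀ (B : Matrix ι ι ℂ) i j, ‖B i j‖ ≤ ‖B‖ := by
    intro B i j
    rw [Matrix.linfty_opNorm_def]
    refine le_trans ?_ (NNReal.coe_le_coe.2 (Finset.le_sup (Finset.mem_univ i)))
    rw [NNReal.coe_sum]
    exact Finset.single_le_sum (f := fun j => (‖B i j‖₊ : ℝ)) (fun _ _ => NNReal.coe_nonneg _)
      (Finset.mem_univ j)
  refine ⟨1 + ∑ k ∈ Finset.range (n₀ + 1), ‖A ^ k‖ / r ^ k, by positivity, fun n i j => ?_⟩
  refine (hentry _ i j).trans ?_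
  rcases lt_or_ge n (n₀ + 1) with hn | hn
  · have := Finset.single_le_sum (f := fun k => ‖A ^ k‖ / r ^ k) (fun _ _ => by positivity)
      (Finset.mem_range.2 hn)
    rw [← div_le_iff₀ (by positivity)]
    linarith
  · refine (hbig n hn).trans (le_mul_of_one_le_left (by positivity) ?_)
    exact le_add_of_nonneg_right (by positivity)

end

/-- Take an eigenvector for an eigenvalue of maximal modulus and compare both sides of `A ^ n *ᵥ x =
z ^ n • x` at a coordinate where `‖x i‖` is largest. -/
theorem spectralRadius_pow_le [Nonempty ι] (A : Matrix ι ι ℂ) (n : ℕ) {c : ℝ}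
    (hc : ∀ i j, ‖(A ^ n) i j‖ ≤ c) :
    (spectralRadius ℂ A).toReal ^ n ≤ Fintype.card ι * c := by
  obtain ⟨z, x, hx, hAx, hz⟩ := exists_mulVec_eq_smul_norm_eq_spectralRadius A
  have hpow : ∀ k : ℕ, (A ^ k) *ᵥ x = z ^ k • x := by
    intro k
    induction k with
    | zero => simp
    | succ k ih => rw [pow_succ, ← Matrix.mulVec_mulVec, hAx, Matrix.mulVec_smul, ih, smul_smul,
        pow_succ']
  obtain ⟨i, hi⟩ := Finite.exists_max fun i => ‖x i‖
  have hxi : 0 < ‖x i‖ := by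
    obtain ⟨j, hj⟩ := Function.ne_iff.1 hx
    exact (norm_pos_iff.2 hj).trans_le (hi j)
  rw [← hz, ← norm_pow]
  refine le_of_mul_le_mul_right ?_ hxi
  have h := congrFun (hpow n) i
  calc ‖z ^ n‖ * ‖x i‖ = ‖∑ j, (A ^ n) i j * x j‖ := by
        rw [← norm_mul]; exact congrArg norm h.symm
    _ ≤ ∑ j, ‖(A ^ n) i j‖ * ‖x j‖ := (norm_sum_le _ _).trans_eq (by simp)
    _ ≤ ∑ _j : ι, c * ‖x i‖ := Finset.sum_le_sum fun j _ =>
        mul_le_mul (hc i j) (hi j) (norm_nonneg _) ((norm_nonneg _).trans (hc i j))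
    _ = Fintype.card ι * c * ‖x i‖ := by simp [mul_assoc]

end Matrix

/-! ### Walks and powers of the edge matrix. -/

namespace MAutomaton

variable {m : ℕ} {A : Type*} [Zero A] {V : Type*}

theorem walkEnd_append (D : MAutomaton m A V) (v : V) (w₁ w₂ : List (Fin m)) :
    D.walkEnd v (w₁ ++ w₂) = D.walkEnd (D.walkEnd v w₁) w₂ :=
  List.foldl_append

theorem reaches_refl (D : MAutomaton m A V) (v : V) : D.Reaches v v :=
  ⟨[], rfl⟩

theorem Reaches.trans {D : MAutomaton m A V} {u v w : V} (h₁ : D.Reaches u v)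
    (h₂ : D.Reaches v w) : D.Reaches u w := by
  obtain ⟨x, rfl⟩ := h₁
  obtain ⟨y, rfl⟩ := h₂
  exact ⟨x ++ y, D.walkEnd_append _ _ _⟩

theorem reaches_next (D : MAutomaton m A V) (v : V) (d : Fin m) : D.Reaches v (D.next v d) :=
  ⟨[d], rfl⟩

theorem mem_component_self (D : MAutomaton m A V) (v : V) : v ∈ D.component v :=
  ⟨D.reaches_refl v, D.reaches_refl v⟩

/-- A vertex is live if a vertex with non-zero label can be reached from it. -/
def Live (D : MAutomaton m A V) (v : V) : Prop :=
  ∃ u : V, D.Reaches v u ∧ D.label u ≠ 0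

theorem Live.of_reaches {D : MAutomaton m A V} {u v : V} (h : D.Reaches u v) (hv : D.Live v) :
    D.Live u := by
  obtain ⟨w, hw, hw0⟩ := hv
  exact ⟨w, h.trans hw, hw0⟩

/-- The matrix of the whole automaton: its entry at `(u, w)` is the number of edges from `u` to
`w`. -/
noncomputable def edgeMatrix (D : MAutomaton m A V) : Matrix V V ℕ :=
  Matrix.of fun u w => Nat.card {d : Fin m // D.next u d = w}

theorem exists_next_eq_of_edgeMatrix_ne_zero {D : MAutomaton m A V} {u w : V}
    (h : D.edgeMatrix u w ≠ 0) : ∃ d, D.next u d = w := by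
  have : Nonempty {d : Fin m // D.next u d = w} := (Nat.card_ne_zero.1 h).1
  exact ⟨this.some.1, this.some.2⟩

section

variable [Fintype V] [DecidableEq V]

theorem edgeMatrix_mulVec (D : MAutomaton m A V) (g : V → ℕ) (u : V) :
    (D.edgeMatrix.mulVec g) u = ∑ d, g (D.next u d) := by
  have h : ∀ w, D.edgeMatrix u w * g w = ∑ d, if D.next u d = w then g w else 0 := by
    intro w
    rw [← Finset.sum_filter, Finset.sum_const, smul_eq_mul, edgeMatrix, Matrix.of_apply,
      Nat.card_eq_fintype_card, Fintype.card_subtype]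
  simp only [Matrix.mulVec, dotProduct, h]
  rw [Finset.sum_comm]
  simp

theorem edgeMatrix_pow_succ_apply (D : MAutomaton m A V) (n : ℕ) (u w : V) :
    (D.edgeMatrix ^ (n + 1)) u w = ∑ d, (D.edgeMatrix ^ n) (D.next u d) w := by
  rw [pow_succ', ← D.edgeMatrix_mulVec fun x => (D.edgeMatrix ^ n) x w]
  rfl

/-- Powers of the edge matrix count walks. -/
theorem edgeMatrix_pow_apply (D : MAutomaton m A V) (n : ℕ) (u w : V) :
    (D.edgeMatrix ^ n) u w =
      Fintype.card {x : Fin n → Fin m // D.walkEnd u (List.ofFn x) = w} := by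
  induction n generalizing u with
  | zero =>
    rw [pow_zero, Matrix.one_apply, Fintype.card_subtype]
    simp [walkEnd, Finset.filter_const]
    split_ifs <;> rfl
  | succ n ih =>
    simp only [edgeMatrix_pow_succ_apply, ih, Fintype.card_subtype, Finset.card_filter]
    rw [← (Fin.consEquiv fun _ : Fin (n + 1) => Fin m).sum_comp, Fintype.sum_prod_type]
    refine Finset.sum_congr rfl fun d _ => Finset.sum_congr rfl fun x _ => ?_
    simp [Fin.consEquiv, walkEnd, List.ofFn_succ]
    rfl

theorem reaches_iff (D : MAutomaton m A V) (u w : V) :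
    D.Reaches u w ↔ ∃ n, (D.edgeMatrix ^ n) u w ≠ 0 := by
  constructor
  · rintro ⟨x, hx⟩
    refine ⟨x.length, ?_⟩
    rw [edgeMatrix_pow_apply]
    have : Nonempty {y : Fin x.length → Fin m // D.walkEnd u (List.ofFn y) = w} :=
      ⟨⟨x.get, by rwa [List.ofFn_get]⟩⟩
    exact Fintype.card_ne_zero
  · rintro ⟨n, hn⟩
    rw [edgeMatrix_pow_apply, ← Nat.pos_iff_ne_zero, Fintype.card_pos_iff] at hn
    exact ⟨_, hn.some.2⟩

theorem mem_tied_iff (D : MAutomaton m A V) (v : V) :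
    v ∈ D.tied ↔ D.Live v ∧ ∃ n, 2 ≤ (D.edgeMatrix ^ n) v v := by
  refine and_congr Iff.rfl ?_
  constructor
  · rintro ⟨w₁, w₂, hne, hlen, h₁, h₂⟩
    refine ⟨w₁.length, ?_⟩
    obtain ⟨n, hn⟩ : ∃ n, n = w₁.length := ⟨_, rfl⟩
    rw [← hn, edgeMatrix_pow_apply]
    have hn₂ : n = w₂.length := hn.trans hlen
    obtain ⟨x, rfl⟩ : ∃ x : Fin n → Fin m, w₁ = List.ofFn x := by
      subst hn; exact ⟨w₁.get, (List.ofFn_get _).symm⟩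
    obtain ⟨y, rfl⟩ : ∃ y : Fin n → Fin m, w₂ = List.ofFn y := by
      subst hn₂; exact ⟨w₂.get, (List.ofFn_get _).symm⟩
    refine Fintype.one_lt_card_iff.2 ⟨⟨x, h₁⟩, ⟨y, h₂⟩, fun h => hne ?_⟩
    rw [Subtype.mk.inj h]
  · rintro ⟨n, hn⟩
    rw [edgeMatrix_pow_apply] at hn
    obtain ⟨⟨x, hx⟩, ⟨y, hy⟩, hxy⟩ := Fintype.one_lt_card_iff.1 hn
    exact ⟨List.ofFn x, List.ofFn y, fun h => hxy (Subtype.ext (List.ofFn_injective h)), by simp,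
      hx, hy⟩

theorem edgeMatrix_pow_mul_le (D : MAutomaton m A V) (p q : ℕ) (u x w : V) :
    (D.edgeMatrix ^ p) u x * (D.edgeMatrix ^ q) x w ≤ (D.edgeMatrix ^ (p + q)) u w := by
  rw [pow_add, Matrix.mul_apply]
  exact Finset.single_le_sum (f := fun x => (D.edgeMatrix ^ p) u x * (D.edgeMatrix ^ q) x w)
    (fun _ _ => Nat.zero_le _) (Finset.mem_univ x)

theorem pow_le_edgeMatrix_pow_mul (D : MAutomaton m A V) (n k : ℕ) (v : V) :
    (D.edgeMatrix ^ n) v v ^ k ≤ (D.edgeMatrix ^ (n * k)) v v := by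
  induction k with
  | zero => simp
  | succ k ih =>
    rw [pow_succ, mul_add_one]
    exact (Nat.mul_le_mul_right _ ih).trans (D.edgeMatrix_pow_mul_le _ _ _ _ _)

end

open Classical in
theorem sum_component_eq [Fintype V] {D : MAutomaton m A V} {v : V} {M : Type*} [AddCommMonoid M] {f : V → M}
    (hf : ∀ x, x ∉ D.component v → f x = 0) : ∑ x : D.component v, f x = ∑ x, f x := by
  rw [← Finset.sum_subset (Finset.subset_univ (D.component v).toFinset)
    fun x _ hx => hf x (by simpa using hx)]
  exact (Finset.sum_subtype _ (by simp) f).symm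

-- A walk between two vertices of a component never leaves it, so restriction to the component
-- commutes with powers.
open Classical in
theorem adjMatrix_pow_apply [Fintype V] (D : MAutomaton m A V) (v : V) (n : ℕ)
    (u w : D.component v) : (D.adjMatrix v ^ n) u w = ((D.edgeMatrix ^ n) u w : ℂ) := by
  induction n generalizing u with
  | zero => simp [Matrix.one_apply, Subtype.ext_iff]
  | succ n ih =>
    rw [pow_succ', Matrix.mul_apply, pow_succ', Matrix.mul_apply, Nat.cast_sum]
    simp only [ih, Nat.cast_mul]
    refine sum_component_eq (f := fun x : V =>
      (D.edgeMatrix u x : ℂ) * ((D.edgeMatrix ^ n) x w : ℂ)) fun x hx => ?_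
    by_contra h
    obtain ⟨h1, h2⟩ := mul_ne_zero_iff.1 h
    obtain ⟨d, rfl⟩ := exists_next_eq_of_edgeMatrix_ne_zero (Nat.cast_ne_zero.1 h1)
    exact hx ⟨((D.reaches_iff _ _).2 ⟨n, Nat.cast_ne_zero.1 h2⟩).trans w.2.1,
      u.2.2.trans (D.reaches_next _ _)⟩

end MAutomaton

namespace MAutomaton

variable {m : ℕ} {A : Type*} [Zero A] {V : Type*}

/-! ### Tied vertices and the threshold `rho = 1`. -/

section Rho

variable [Fintype V]

open Classical in
theorem exists_rho_pow_le (D : MAutomaton m A V) (v : V) (n : ℕ) :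
    ∃ u ∈ D.component v, ∃ w ∈ D.component v,
      D.rho v ^ n ≤ Fintype.card V * ((D.edgeMatrix ^ n) u w : ℝ) := by
  have : Nonempty (D.component v) := ⟨⟨v, D.mem_component_self v⟩⟩
  obtain ⟨⟨u, w⟩, h⟩ := Finite.exists_max fun p : D.component v × D.component v =>
    (D.edgeMatrix ^ n) p.1 p.2
  refine ⟨u, u.2, w, w.2, ?_⟩
  have h' := Matrix.spectralRadius_pow_le (D.adjMatrix v) n
    (c := ((D.edgeMatrix ^ n) (u : V) (w : V) : ℝ)) fun i j => by
      rw [adjMatrix_pow_apply, Complex.norm_natCast, Nat.cast_le]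
      exact h (i, j)
  refine h'.trans (mul_le_mul_of_nonneg_right ?_ (Nat.cast_nonneg _))
  exact_mod_cast Fintype.card_subtype_le _

/-- Two closed walks of length `L` combine to at least `2 ^ k` closed walks of length `L * k`, too
many if the spectral radius were at most 1. -/
theorem one_lt_rho_of_mem_tied {D : MAutomaton m A V} {v : V} (hv : v ∈ D.tied) :
    1 < D.rho v := by
  classical
  have : Nonempty (D.component v) := ⟨⟨v, D.mem_component_self v⟩⟩
  obtain ⟨-, L, hL⟩ := (D.mem_tied_iff v).1 hv
  have hL0 : L ≠ 0 := by
    rintro rfl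
    simp at hL
  by_contra! hle
  -- The rate `r` satisfies `r ^ L = 3 / 2`; any value strictly between 1 and 2 would do.
  have hr1 : 1 < (3 / 2 : ℝ) ^ ((L : ℝ)⁻¹) :=
    Real.one_lt_rpow (by norm_num) (inv_pos.2 (Nat.cast_pos.2 (Nat.pos_of_ne_zero hL0)))
  have hrL : ((3 / 2 : ℝ) ^ ((L : ℝ)⁻¹)) ^ L = 3 / 2 :=
    Real.rpow_inv_natCast_pow (by norm_num) hL0
  obtain ⟨C, -, hC⟩ := Matrix.exists_norm_pow_apply_le (D.adjMatrix v)
    (r := (3 / 2 : ℝ) ^ ((L : ℝ)⁻¹)) (by simpa [rho] using hle.trans_lt hr1)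
  obtain ⟨k, hk⟩ := pow_unbounded_of_one_lt C (by norm_num : (1 : ℝ) < 4 / 3)
  have h1 := hC (L * k) ⟨v, D.mem_component_self v⟩ ⟨v, D.mem_component_self v⟩
  rw [adjMatrix_pow_apply, Complex.norm_natCast, pow_mul ((3 / 2 : ℝ) ^ ((L : ℝ)⁻¹)), hrL] at h1
  have h2 : (2 : ℝ) ^ k ≤ ((D.edgeMatrix ^ (L * k)) v v : ℝ) := by
    exact_mod_cast (Nat.pow_le_pow_left hL k).trans (D.pow_le_edgeMatrix_pow_mul L k v)
  have h3 : (2 : ℝ) ^ k = (4 / 3) ^ k * (3 / 2) ^ k := by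
    rw [← mul_pow]; norm_num
  have h4 : (4 / 3 : ℝ) ^ k * (3 / 2) ^ k ≤ C * (3 / 2) ^ k := h3 ▸ h2.trans h1
  exact absurd (le_of_mul_le_mul_right h4 (by positivity)) (not_le.2 hk)

/-- Walks inside the component, closed up through `v` by fixed connecting walks, stay distinct;
hence all entries of the powers are at most 1 and `rho v ^ n` is bounded by `card V`. -/
theorem rho_le_one_of_live {D : MAutomaton m A V} {v : V} (hv : D.Live v) (h : v ∉ D.tied) :
    D.rho v ≤ 1 := by
  classical
  have hle : ∀ n, (D.edgeMatrix ^ n) v v ≤ 1 := by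
    intro n
    by_contra! hn
    exact h ((D.mem_tied_iff v).2 ⟨hv, n, hn⟩)
  by_contra! hlt
  obtain ⟨n, hn⟩ := pow_unbounded_of_one_lt (Fintype.card V : ℝ) hlt
  obtain ⟨u, hu, w, hw, huw⟩ := D.exists_rho_pow_le v n
  obtain ⟨p, hp⟩ := (D.reaches_iff _ _).1 hu.2
  obtain ⟨q, hq⟩ := (D.reaches_iff _ _).1 hw.1
  have h1 : (D.edgeMatrix ^ n) u w ≤ 1 := by
    refine le_trans ?_ (hle (p + n + q))
    refine le_trans ?_ (D.edgeMatrix_pow_mul_le (p + n) q v w v)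
    refine le_trans ?_ (Nat.mul_le_mul_right _ (D.edgeMatrix_pow_mul_le p n v u w))
    exact (Nat.le_mul_of_pos_left _ (Nat.pos_of_ne_zero hp)).trans
      (Nat.le_mul_of_pos_right _ (Nat.pos_of_ne_zero hq))
  have h2 : ((D.edgeMatrix ^ n) u w : ℝ) ≤ 1 := by exact_mod_cast h1
  exact absurd (huw.trans (mul_le_of_le_one_right (Nat.cast_nonneg _) h2)) (not_le.2 hn)

end Rho

/-! ### Upper bound for walks ending in live vertices. -/

section LiveMatrix

open Classical in
/-- The edge matrix without the edges that end in a vertex that is not live. -/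
noncomputable def liveMatrix (D : MAutomaton m A V) : Matrix V V ℂ :=
  Matrix.of fun u w => if D.Live w then (D.edgeMatrix u w : ℂ) else 0

variable [Fintype V]

open Classical in
theorem liveMatrix_pow_apply (D : MAutomaton m A V) (n : ℕ) (v : V) {w : V} (hw : D.Live w) :
    (D.liveMatrix ^ n) v w = ((D.edgeMatrix ^ n) v w : ℂ) := by
  induction n generalizing v with
  | zero => simp [Matrix.one_apply]
  | succ n ih =>
    rw [pow_succ', Matrix.mul_apply, pow_succ', Matrix.mul_apply, Nat.cast_sum]
    refine Finset.sum_congr rfl fun t _ => ?_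
    rw [ih, Nat.cast_mul, liveMatrix, Matrix.of_apply]
    by_cases h : (D.edgeMatrix ^ n) t w = 0
    · simp [h]
    · rw [if_pos (Live.of_reaches ((D.reaches_iff _ _).2 ⟨n, h⟩) hw)]

/-- A nonempty set of vertices contains a vertex whose strongly connected component is terminal
among the components meeting the set. -/
theorem exists_terminal (D : MAutomaton m A V) {s : Set V} (hs : s.Nonempty) :
    ∃ u ∈ s, ∀ w ∈ s, D.Reaches u w → D.Reaches w u := by
  -- Reachability is reversed, so that minimal means terminal.
  let _ : Preorder V :=
    { le := fun a b => D.Reaches b a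
      le_refl := D.reaches_refl
      le_trans := fun _ _ _ h₁ h₂ => Reaches.trans h₂ h₁ }
  obtain ⟨u, hu⟩ := s.toFinite.exists_minimal hs
  exact ⟨u, hu.1, fun w hw h => hu.2 hw h⟩

-- In place of a block triangular form: restrict an eigenvector to a component that is terminal
-- among those meeting its support. No other component contributes to the eigenvalue equation there,
-- so the restriction is an eigenvector of `adjMatrix`.
open Classical in
theorem spectralRadius_liveMatrix_le (D : MAutomaton m A V) {R : ℝ} (hR : 0 ≤ R)
    (h : ∀ v, D.Live v → D.rho v ≤ R) : (spectralRadius ℂ D.liveMatrix).toReal ≤ R := by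
  have : Nonempty V := ⟨D.start⟩
  obtain ⟨z, x, hx, hzx, hz⟩ := Matrix.exists_mulVec_eq_smul_norm_eq_spectralRadius D.liveMatrix
  rw [← hz]
  by_cases hz0 : z = 0
  · simpa [hz0] using hR
  have heq : ∀ w, ∑ t, D.liveMatrix w t * x t = z * x w := fun w => congrFun hzx w
  have hlive : ∀ w, x w ≠ 0 → D.Live w := by
    intro w hw
    have hne := mul_ne_zero hz0 hw
    rw [← heq w] at hne
    obtain ⟨t, -, ht⟩ := Finset.exists_ne_zero_of_sum_ne_zero hne
    have ht' := left_ne_zero_of_mul ht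
    rw [liveMatrix, Matrix.of_apply] at ht'
    split_ifs at ht' with hl
    · obtain ⟨d, rfl⟩ := exists_next_eq_of_edgeMatrix_ne_zero (Nat.cast_ne_zero.1 ht')
      exact hl.of_reaches (D.reaches_next w d)
    · exact absurd rfl ht'
  obtain ⟨u, hu, hterm⟩ := D.exists_terminal (s := {w | x w ≠ 0}) (Function.ne_iff.1 hx)
  have : Nonempty (D.component u) := ⟨⟨u, D.mem_component_self u⟩⟩
  refine le_trans ?_ (h u (hlive u hu))
  refine Matrix.norm_le_spectralRadius_of_mulVec_eq_smul (D.adjMatrix u)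
    (x := fun w : D.component u => x w) ?_ ?_
  · exact Function.ne_iff.2 ⟨⟨u, D.mem_component_self u⟩, hu⟩
  · ext w
    refine Eq.trans ?_ (heq w)
    refine (sum_component_eq (f := fun t : V => (D.edgeMatrix w t : ℂ) * x t)
      fun t ht => ?_).trans (Finset.sum_congr rfl fun t _ => ?_)
    · by_contra hne
      obtain ⟨h1, h2⟩ := mul_ne_zero_iff.1 hne
      obtain ⟨d, rfl⟩ := exists_next_eq_of_edgeMatrix_ne_zero (Nat.cast_ne_zero.1 h1)
      have hr := w.2.2.trans (D.reaches_next _ d)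
      exact ht ⟨hterm _ h2 hr, hr⟩
    · rw [liveMatrix, Matrix.of_apply]
      by_cases h2 : x t = 0
      · simp [h2]
      · rw [if_pos (hlive t h2)]

open Classical in
theorem exists_edgeMatrix_pow_le (D : MAutomaton m A V) {R r : ℝ} (hR : 0 ≤ R)
    (h : ∀ v, D.Live v → D.rho v ≤ R) (hr : R < r) :
    ∃ C : ℝ, 0 ≤ C ∧ ∀ (n : ℕ) (v w : V), D.Live w →
      ((D.edgeMatrix ^ n) v w : ℝ) ≤ C * r ^ n := by
  have : Nonempty V := ⟨D.start⟩
  obtain ⟨C, hC0, hC⟩ := Matrix.exists_norm_pow_apply_le D.liveMatrix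
    ((D.spectralRadius_liveMatrix_le hR h).trans_lt hr)
  refine ⟨C, hC0, fun n v w hw => ?_⟩
  have := hC n v w
  rwa [D.liveMatrix_pow_apply n v hw, Complex.norm_natCast] at this

end LiveMatrix

end MAutomaton

/-! ### Counting the support by words. -/

namespace MAutomaton

variable {m : ℕ} {A : Type*} [Zero A] {V : Type*}

/-- The label of the vertex reached from `v` by following the base-`m` digits of `k`. -/
def value (D : MAutomaton m A V) (hm : 2 ≤ m) (v : V) (k : ℕ) : A :=
  D.label (D.walkEnd v
    ((Nat.digits m k).pmap (fun d hd => (⟨d, hd⟩ : Fin m))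
      (fun _ hd => Nat.digits_lt_base hm hd)))

theorem value_zero (D : MAutomaton m A V) (hm : 2 ≤ m) (v : V) : D.value hm v 0 = D.label v := by
  simp [value, walkEnd]

theorem value_add_mul (D : MAutomaton m A V) (hm : 2 ≤ m) (v : V) (d : Fin m) (k : ℕ) :
    D.value hm v (d + m * k) = D.value hm (D.next v d) k := by
  -- Zero has no digits, so here the edge labelled 0 is not followed; leading zero invariance makes
  -- up for it.
  by_cases h : (d : ℕ) = 0 ∧ k = 0
  · obtain ⟨hd, rfl⟩ := h
    rw [hd, mul_zero, zero_add, value_zero, value_zero, D.leadingZero v d hd]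
  · have hdig := Nat.digits_add m hm d k d.2 (by tauto)
    have key : ∀ (l : List ℕ) (hl : ∀ a ∈ l, a < m) (h' : ∀ a ∈ Nat.digits m k, a < m),
        l = (d : ℕ) :: Nat.digits m k →
        l.pmap (fun d hd => (⟨d, hd⟩ : Fin m)) hl =
          d :: (Nat.digits m k).pmap (fun d hd => (⟨d, hd⟩ : Fin m)) h' := by
      rintro l hl h' rfl
      rfl
    rw [value, key _ _ (fun _ hd => Nat.digits_lt_base hm hd) hdig]
    rfl

open Classical in
/-- The number of words of length `n` that lead from `v` to a vertex with non-zero label. -/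
noncomputable def supportCount (D : MAutomaton m A V) (hm : 2 ≤ m) (v : V) (n : ℕ) : ℕ :=
  ((Finset.range (m ^ n)).filter fun k => D.value hm v k ≠ 0).card

open Classical in
theorem supportCount_zero (D : MAutomaton m A V) (hm : 2 ≤ m) (v : V) :
    D.supportCount hm v 0 = if D.label v ≠ 0 then 1 else 0 := by
  simp only [supportCount, Finset.card_filter, pow_zero, Finset.range_one, Finset.sum_singleton,
    value_zero]

theorem supportCount_succ (D : MAutomaton m A V) (hm : 2 ≤ m) (v : V) (n : ℕ) :
    D.supportCount hm v (n + 1) = ∑ d, D.supportCount hm (D.next v d) n := by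
  classical
  simp only [supportCount, Finset.card_filter, Finset.sum_range, pow_succ]
  rw [← finProdFinEquiv.sum_comp, Fintype.sum_prod_type_right]
  refine Finset.sum_congr rfl fun d _ => Finset.sum_congr rfl fun k _ => ?_
  simp only [finProdFinEquiv_apply_val, value_add_mul]

open Classical in
theorem supportCount_eq [Fintype V] (D : MAutomaton m A V) (hm : 2 ≤ m) (v : V) (n : ℕ) :
    D.supportCount hm v n = ∑ w, if D.label w ≠ 0 then (D.edgeMatrix ^ n) v w else 0 := by
  induction n generalizing v with
  | zero =>
    rw [supportCount_zero, Finset.sum_eq_single v]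
    · simp
    · intro w _ hw
      simp [Matrix.one_apply_ne hw.symm]
    · simp
  | succ n ih =>
    simp only [supportCount_succ, ih, edgeMatrix_pow_succ_apply]
    rw [Finset.sum_comm]
    refine Finset.sum_congr rfl fun w _ => ?_
    split_ifs <;> simp

theorem supportCount_mono (D : MAutomaton m A V) (hm : 2 ≤ m) (v : V) :
    Monotone (D.supportCount hm v) := by
  classical
  intro a b hab
  refine Finset.card_le_card (Finset.filter_subset_filter _ (Finset.range_mono ?_))
  exact Nat.pow_le_pow_right (by omega) hab

theorem exists_supportCount_le [Fintype V] (D : MAutomaton m A V) (hm : 2 ≤ m) {R r : ℝ}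
    (hR : 0 ≤ R) (h : ∀ v, D.Live v → D.rho v ≤ R) (hr : R < r) :
    ∃ C : ℝ, 0 ≤ C ∧ ∀ (n : ℕ) (v : V), (D.supportCount hm v n : ℝ) ≤ C * r ^ n := by
  classical
  obtain ⟨C, hC0, hC⟩ := D.exists_edgeMatrix_pow_le hR h hr
  refine ⟨Fintype.card V * C, by positivity, fun n v => ?_⟩
  rw [supportCount_eq, Nat.cast_sum]
  calc _ ≤ ∑ _w : V, C * r ^ n := Finset.sum_le_sum fun w _ => ?_
    _ = _ := by simp [mul_assoc]
  split_ifs with hw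
  · exact hC n v w ⟨w, D.reaches_refl w, hw⟩
  · simpa using mul_nonneg hC0 (pow_nonneg (hR.trans hr.le) n)

/-- The best pair `u`, `w` varies with `n`, so `c` must bound the connecting walks for all vertices
at once; sums over `V` do this, and monotonicity in the length evens out the difference. -/
theorem exists_rho_pow_le_supportCount [Fintype V] (D : MAutomaton m A V) (hm : 2 ≤ m) {v : V}
    (hv : D.Live v) :
    ∃ c : ℕ, ∀ n : ℕ,
      D.rho v ^ n ≤ Fintype.card V * (D.supportCount hm D.start (n + c) : ℝ) := by
  classical
  obtain ⟨z, hvz, hz⟩ := hv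
  have hp : ∀ u : V, ∃ p, (D.edgeMatrix ^ p) D.start u ≠ 0 := fun u =>
    (D.reaches_iff _ _).1 (D.accessible u)
  have hq : ∀ w : V, ∃ q, w ∈ D.component v → (D.edgeMatrix ^ q) w z ≠ 0 := by
    intro w
    by_cases hw : w ∈ D.component v
    · obtain ⟨q, hq⟩ := (D.reaches_iff _ _).1 (hw.1.trans hvz)
      exact ⟨q, fun _ => hq⟩
    · exact ⟨0, fun h => absurd h hw⟩
  choose p hp using hp
  choose q hq using hq
  refine ⟨∑ u, p u + ∑ w, q w, fun n => ?_⟩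
  obtain ⟨u, -, w, hw, huw⟩ := D.exists_rho_pow_le v n
  refine huw.trans (mul_le_mul_of_nonneg_left (Nat.cast_le.2 ?_) (Nat.cast_nonneg _))
  have hpu := Finset.single_le_sum (f := p) (fun _ _ => Nat.zero_le _) (Finset.mem_univ u)
  have hqw := Finset.single_le_sum (f := q) (fun _ _ => Nat.zero_le _) (Finset.mem_univ w)
  refine le_trans ?_ (D.supportCount_mono hm D.start
    (show p u + n + q w ≤ n + (∑ u, p u + ∑ w, q w) by omega))
  have h1 : (D.edgeMatrix ^ (p u + n + q w)) D.start z ≤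
      D.supportCount hm D.start (p u + n + q w) := by
    rw [supportCount_eq]
    refine le_trans ?_ (Finset.single_le_sum (fun _ _ => Nat.zero_le _) (Finset.mem_univ z))
    rw [if_pos hz]
  refine le_trans ?_ h1
  refine le_trans ?_ (D.edgeMatrix_pow_mul_le (p u + n) (q w) D.start w z)
  refine le_trans ?_ (Nat.mul_le_mul_right _ (D.edgeMatrix_pow_mul_le (p u) n D.start u w))
  exact (Nat.le_mul_of_pos_left _ (Nat.pos_of_ne_zero (hp u))).trans
    (Nat.le_mul_of_pos_right _ (Nat.pos_of_ne_zero (hq w hw)))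

/-! ### From word counts to growth exponents. -/

theorem finite_supportUpTo (a : ℕ → A) (N : ℕ) : (supportUpTo a N).Finite :=
  (Set.finite_Iic N).subset fun _ hk => hk.2.1

theorem ncard_supportUpTo_le (D : MAutomaton m A V) (hm : 2 ≤ m) {N n : ℕ} (h : N < m ^ n) :
    (supportUpTo (D.sequence hm) N).ncard ≤ D.supportCount hm D.start n := by
  classical
  rw [supportCount, ← Set.ncard_coe_finset]
  refine Set.ncard_le_ncard (fun k hk => ?_) (Finset.finite_toSet _)
  exact Finset.mem_coe.2 (Finset.mem_filter.2 ⟨Finset.mem_range.2 (hk.2.1.trans_lt h), hk.2.2⟩)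

theorem supportCount_le_ncard_supportUpTo (D : MAutomaton m A V) (hm : 2 ≤ m) {N n : ℕ}
    (h : m ^ n ≤ N) :
    D.supportCount hm D.start n ≤ (supportUpTo (D.sequence hm) N).ncard + 1 := by
  classical
  rw [supportCount, ← Set.ncard_coe_finset]
  -- The words also count `k = 0`, which `supportUpTo` omits.
  refine le_trans (Set.ncard_le_ncard (t := insert 0 (supportUpTo (D.sequence hm) N))
    (fun k hk => ?_) ((finite_supportUpTo _ _).insert 0)) (Set.ncard_insert_le _ _)
  obtain ⟨h1, h2⟩ := Finset.mem_filter.1 (Finset.mem_coe.1 hk)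
  rcases Nat.eq_zero_or_pos k with rfl | hk0
  · exact Set.mem_insert _ _
  · exact Set.mem_insert_of_mem _ ⟨hk0, (Finset.mem_range.1 h1).le.trans h, h2⟩

theorem rpow_le_of_mem_growthExponents [Fintype V] (D : MAutomaton m A V) (hm : 2 ≤ m) {R α : ℝ}
    (hR : 0 ≤ R) (h : ∀ v, D.Live v → D.rho v ≤ R)
    (hα : α ∈ growthExponents (D.sequence hm)) : (m : ℝ) ^ α ≤ R := by
  have hm0 : (0 : ℝ) ≤ m := Nat.cast_nonneg m
  refine le_of_forall_gt_imp_ge_of_dense fun r hr => ?_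
  have hr0 : 0 < r := hR.trans_lt hr
  obtain ⟨C, hC0, hC⟩ := D.exists_supportCount_le hm hR h hr
  obtain ⟨-, N₀, hN₀⟩ := hα
  by_contra! hlt
  -- The extra factor `r` pays for the exponent `n + 1` needed to have `m ^ n` strictly below a
  -- power of `m`.
  obtain ⟨k, hk⟩ := pow_unbounded_of_one_lt (C * r) ((one_lt_div hr0).2 hlt)
  have hn : N₀ ≤ m ^ (N₀ + k) :=
    (Nat.lt_pow_self (by omega)).le.trans (Nat.pow_le_pow_right (by omega) (Nat.le_add_right _ k))
  have h1 := hN₀ _ hn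
  have h2 := D.ncard_supportUpTo_le hm
    (Nat.pow_lt_pow_right (by omega : 1 < m) (Nat.lt_succ_self (N₀ + k)))
  have h3 : (((m ^ (N₀ + k) : ℕ) : ℝ)) ^ α ≤ C * r ^ (N₀ + k + 1) :=
    h1.trans ((Nat.cast_le.2 h2).trans (hC _ _))
  rw [Nat.cast_pow, ← Real.rpow_natCast, ← Real.rpow_mul hm0, mul_comm, Real.rpow_mul hm0,
    Real.rpow_natCast, pow_succ', ← mul_assoc, ← div_le_iff₀ (by positivity), ← div_pow] at h3
  have h4 : ((m : ℝ) ^ α / r) ^ k ≤ ((m : ℝ) ^ α / r) ^ (N₀ + k) :=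
    pow_le_pow_right₀ ((one_lt_div hr0).2 hlt).le (Nat.le_add_left _ _)
  linarith

theorem mem_growthExponents_of_rpow_lt [Fintype V] (D : MAutomaton m A V) (hm : 2 ≤ m) {v : V}
    (hv : D.Live v) {α : ℝ} (hα : 0 < α) (h : (m : ℝ) ^ α < D.rho v) :
    α ∈ growthExponents (D.sequence hm) := by
  have hm0 : (0 : ℝ) ≤ m := Nat.cast_nonneg m
  have hm1 : (1 : ℝ) < m := by exact_mod_cast hm
  obtain ⟨c, hc⟩ := D.exists_rho_pow_le_supportCount hm hv
  set K : ℝ := (Fintype.card V : ℝ)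
  have hK0 : 0 < K := by
    have : Nonempty V := ⟨v⟩
    exact Nat.cast_pos.2 Fintype.card_pos
  set b : ℝ := (m : ℝ) ^ α
  have hb1 : 1 < b := Real.one_lt_rpow hm1 hα
  have hb0 : 0 < b := one_pos.trans hb1
  -- `b ^ (c + 1)` covers the `c` connecting digits and the rounding of `N` to a power of `m`; the
  -- last `+ 1` covers `k = 0` in the support count.
  obtain ⟨k, hk⟩ := pow_unbounded_of_one_lt (K * (b ^ (c + 1) + 1)) ((one_lt_div hb0).2 h)
  refine ⟨hα, m ^ (k + c), fun N hN => ?_⟩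
  have hN0 : N ≠ 0 := (lt_of_lt_of_le (Nat.pow_pos (by omega)) hN).ne'
  obtain ⟨j, hj⟩ : ∃ j, Nat.log m N = k + j + c := by
    obtain ⟨j, hj⟩ := Nat.exists_eq_add_of_le ((Nat.le_log_iff_pow_le (by omega) hN0).2 hN)
    exact ⟨j, by omega⟩
  have hlow : m ^ (k + j + c) ≤ N := hj ▸ Nat.pow_log_le_self m hN0
  have hup : N < m ^ (k + j + c + 1) := hj ▸ Nat.lt_pow_succ_log_self (by omega) N
  have h1 : (N : ℝ) ^ α ≤ b ^ (k + j + (c + 1)) := by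
    have : (N : ℝ) ≤ (m : ℝ) ^ (k + j + c + 1) := by exact_mod_cast hup.le
    refine (Real.rpow_le_rpow (Nat.cast_nonneg _) this hα.le).trans_eq ?_
    rw [← Real.rpow_natCast, ← Real.rpow_mul hm0, mul_comm, Real.rpow_mul hm0, Real.rpow_natCast]
    rfl
  have h2 : (D.supportCount hm D.start (k + j + c) : ℝ) ≤
      (supportUpTo (D.sequence hm) N).ncard + 1 := by
    exact_mod_cast D.supportCount_le_ncard_supportUpTo hm hlow
  have h3 := hc (k + j)
  have h4 : K * (b ^ (c + 1) + 1) ≤ (D.rho v / b) ^ (k + j) :=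
    hk.le.trans (pow_le_pow_right₀ ((one_lt_div hb0).2 h).le (Nat.le_add_right _ _))
  rw [div_pow, le_div_iff₀ (by positivity)] at h4
  have h5 : (b ^ (c + 1) + 1) * b ^ (k + j) ≤ D.supportCount hm D.start (k + j + c) :=
    le_of_mul_le_mul_left (by rw [← mul_assoc]; exact h4.trans h3) hK0
  have h6 : 1 ≤ b ^ (k + j) := one_le_pow₀ hb1.le
  rw [pow_add b (k + j)] at h1
  nlinarith

end MAutomaton

theorem theorem4p7 {m : ℕ} (hm : 2 ≤ m) {A : Type*} [Zero A] {V : Type*} [Fintype V]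
    (D : MAutomaton m A V) :
    (D.tied.Nonempty →
      ∃ B : ℝ, IsGreatest ((fun v => Real.logb (m : ℝ) (D.rho v)) '' D.tied) B ∧
        IsLUB (growthExponents (D.sequence hm)) B) ∧
    (D.tied = ∅ → growthExponents (D.sequence hm) = ∅) := by
  have hm1 : (1 : ℝ) < m := by exact_mod_cast hm
  have hm0 : (0 : ℝ) < m := one_pos.trans hm1
  constructor
  · intro hne
    obtain ⟨v, hv, hmax⟩ := Set.exists_max_image D.tied D.rho (Set.toFinite _) hne
    have hv1 : 1 < D.rho v := MAutomaton.one_lt_rho_of_mem_tied hv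
    have hv0 : 0 < D.rho v := one_pos.trans hv1
    refine ⟨Real.logb m (D.rho v), ⟨⟨v, hv, rfl⟩, ?_⟩, ?_, ?_⟩
    · rintro _ ⟨w, hw, rfl⟩
      exact Real.logb_le_logb_of_le hm1 (one_pos.trans (MAutomaton.one_lt_rho_of_mem_tied hw))
        (hmax w hw)
    · intro α hα
      rw [Real.le_logb_iff_rpow_le hm1 hv0]
      refine D.rpow_le_of_mem_growthExponents hm hv0.le (fun w hw => ?_) hα
      by_cases hwt : w ∈ D.tied
      · exact hmax w hwt
      · exact (MAutomaton.rho_le_one_of_live hw hwt).trans hv1.le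
    · intro b hb
      by_contra! hlt
      -- The maximum with 0 keeps `α` positive, as membership requires.
      obtain ⟨α, h1, h2⟩ := exists_between (max_lt hlt (Real.logb_pos hm1 hv1))
      have hmem := D.mem_growthExponents_of_rpow_lt hm hv.1 ((le_max_right b 0).trans_lt h1)
        ((Real.lt_logb_iff_rpow_lt hm1 hv0).1 h2)
      exact absurd (hb hmem) (not_le.2 ((le_max_left b 0).trans_lt h1))
  · intro he
    refine Set.eq_empty_of_forall_notMem fun α hα => ?_
    have h := D.rpow_le_of_mem_growthExponents hm zero_le_one (fun w hw =>
      MAutomaton.rho_le_one_of_live hw (he ▸ Set.notMem_empty w)) hα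
    exact absurd h (not_le.2 (Real.one_lt_rpow hm1 hα.1))
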